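/- Let $F$ be a probability distribution on a measurable space $\mathcal X$ and let $P$ be a Markov transition kernel on $\mathcal X$ that is irreducible, aperiodic and satisfies detailed balance with respect to $F$, i.e. $F(dx)P(x,dy)=F(dy)P(y,dx)$. Let $X_0,X_1,X_2,\dots$ be the stationary Markov chain with transition kernel $P$ and $X_0\sim F$, and let $g:\mathcal X\to\mathbb R^p$ be square integrable with respect to $F$. For $t,i,m\in\mathbb N=\{0,1,2,\dots\}$ put $$\gamma_t=\mathrm{cov}\{g(X_0),g(X_t)\},\qquad \Gamma_i=\gamma_{2i}+\gamma_{2i+1},\qquad \Sigma_m=-\gamma_0+2\sum_{i=0}^m\Gamma_i .$$ Assume that $\sum_{t=0}^\infty\gamma_t$ converges and that the asymptotic covariance matrix $\Sigma=-\gamma_0+2\sum_{t=0}^\infty\gamma_t$ is positive definite. Write $|\cdot|$ for the determinant. Then there is an integer $m_0\ge 0$ such that: (i) for every $m\in\mathbb N$, $\Sigma_m$ is positive definite if and only if $m\ge m_0$; (ii) $|\Sigma_m|>0$ for all $m\ge m_0$; the sequence $(|\Sigma_m|)_{m\ge m_0}$ is non-decreasing, and it is strictly increasing unless $\gamma_t=0$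 for all $t\ge 1$; and $|\Sigma_m|\to|\Sigma|$ as $m\to\infty$. -/

import Mathlib

open MeasureTheory ProbabilityTheory Filter Topology

noncomputable section

namespace MarkovChainCov

variable {S : Type*} [MeasurableSpace S] {Ω : Type*} [MeasurableSpace Ω]

/-- The transition kernel `P` is irreducible: it is `φ`-irreducible for some non-zero
σ-finite measure `φ`. -/
def Irreducible (P : Kernel S S) : Prop :=
  ∃ φ : Measure S, SigmaFinite φ ∧ φ ≠ 0 ∧ Kernel.IsIrreducible φ P

/-- The transition kernel `P` with invariant distribution `F` is aperiodic: there are no `d ≥ 2`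
and disjoint measurable sets `D 0, …, D (d - 1)` with `F (D 0) > 0` through which the chain moves
cyclically, i.e. `P(x, D (i + 1)) = 1` for all `x ∈ D i`, the indices being taken modulo `d`. -/
def Aperiodic (P : Kernel S S) (F : Measure S) : Prop :=
  ∀ d : ℕ, 2 ≤ d → ∀ D : ZMod d → Set S,
    (∀ i, MeasurableSet (D i)) →
    (∀ i j, i ≠ j → Disjoint (D i) (D j)) →
    (∀ i, ∀ x ∈ D i, P x (D (i + 1)) = 1) →
    F (D 0) = 0

/-- `X 0, X 1, …` is, under the probability measure `Pr`, a (time-homogeneous) Markov chain with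
transition kernel `P` and initial distribution `F`: for every `n`, the conditional probability of
`X (n + 1) ∈ A` given `X 0, …, X n` is `P (X n) A`. -/
structure IsMarkovChain (Pr : Measure Ω) (X : ℕ → Ω → S) (P : Kernel S S) (F : Measure S) :
    Prop where
  measurable : ∀ n, Measurable (X n)
  initial : Pr.map (X 0) = F
  markov : ∀ (n : ℕ) (B : Set (Fin (n + 1) → S)) (A : Set S), MeasurableSet B → MeasurableSet A →
    Pr {ω | (fun i : Fin (n + 1) => X i ω) ∈ B ∧ X (n + 1) ω ∈ A} =
      ∫⁻ ω in {ω | (fun i : Fin (n + 1) => X i ω) ∈ B}, P (X n ω) A ∂Pr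

variable {p : ℕ}

/-- The lag `t` autocovariance matrix `γ_t = cov {g (X 0), g (X t)}`. -/
def autocov (Pr : Measure Ω) (X : ℕ → Ω → S) (g : S → EuclideanSpace ℝ (Fin p)) (t : ℕ) :
    Matrix (Fin p) (Fin p) ℝ :=
  Matrix.of fun a b => cov[fun ω => g (X 0 ω) a, fun ω => g (X t ω) b; Pr]

/-- The sum `Γ_i = γ_{2i} + γ_{2i+1}` of an adjacent pair of autocovariances. -/
def pairSum (γ : ℕ → Matrix (Fin p) (Fin p) ℝ) (i : ℕ) : Matrix (Fin p) (Fin p) ℝ :=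
  γ (2 * i) + γ (2 * i + 1)

/-- The partial sum `Σ_m = -γ_0 + 2 ∑_{i=0}^m Γ_i`. -/
def partialCov (γ : ℕ → Matrix (Fin p) (Fin p) ℝ) (m : ℕ) : Matrix (Fin p) (Fin p) ℝ :=
  -γ 0 + (2 : ℝ) • ∑ i ∈ Finset.range (m + 1), pairSum γ i

/-- The series `∑_{t=0}^∞ γ_t` converges, and `Sig = -γ_0 + 2 ∑_{t=0}^∞ γ_t`. -/
def IsAsymptoticCov (γ : ℕ → Matrix (Fin p) (Fin p) ℝ) (Sig : Matrix (Fin p) (Fin p) ℝ) : Prop :=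
  ∃ G : Matrix (Fin p) (Fin p) ℝ,
    Tendsto (fun n => ∑ t ∈ Finset.range n, γ t) atTop (𝓝 G) ∧ Sig = -γ 0 + (2 : ℝ) • G

end MarkovChainCov

end

/-! ### Positive definiteness and determinants in the Loewner order. -/

namespace Matrix

variable {n : Type*} [Fintype n]

/-! By detailed balance the transition operator `T` is symmetric on L²(F) with `1 + T ≥ 0`, and γ_t
has entries ⟨u_a, T^t u_b⟩, where u_a is the centred a-th component of g
(`exists_transitionOperator`, `autocov_eq_inner`). The quadratic form of Γ_i is therefore ⟨T^i h, (1
+ T) T^i h⟩ ≥ 0, so Σ_m increases in the Loewner order. Positive definiteness then persists once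
reached, and it is reached because it is an open condition on symmetric matrices that holds for the
limit Σ.

From there the determinant is monotone, strictly so when the increment is nonzero. If Γ_i = 0 for
some i ≥ 1, then T^i u_b is orthogonal to the range of 1 + T, so the moments of u_b eventually
alternate in sign. Since γ_t → 0 they vanish, and symmetry gives T u_b = 0, whence γ_t = 0 for all t
≥ 1. -/

/-- Compactness of the unit sphere makes openness of x · Nx > 0 uniform in x; scaling covers all x ≠
0. -/
theorem PosDef.eventually {ι : Type*} {l : Filter ι} {A : Matrix n n ℝ} (hA : A.PosDef)
    {M : ι → Matrix n n ℝ} (hM : ∀ i, (M i).IsHermitian) (hlim : Tendsto M l (𝓝 A)) :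
    ∀ᶠ i in l, (M i).PosDef := by
  have hcont : Continuous fun z : Matrix n n ℝ × (n → ℝ) => z.2 ⬝ᵥ (z.1 *ᵥ z.2) := by
    fun_prop
  have hK : IsCompact (Metric.sphere (0 : n → ℝ) 1) := isCompact_sphere _ _
  have hU : ∀ᶠ N in 𝓝 A, ∀ x ∈ Metric.sphere (0 : n → ℝ) 1, 0 < x ⬝ᵥ (N *ᵥ x) := by
    apply hK.eventually_forall_of_forall_eventually
    intro x hx
    have hx0 : x ≠ 0 := by
      rintro rfl
      simp at hx
    have hpos : 0 < x ⬝ᵥ (A *ᵥ x) := by simpa using hA.dotProduct_mulVec_pos hx0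
    exact hcont.continuousAt.eventually (lt_mem_nhds hpos)
  filter_upwards [hlim.eventually hU] with i hi
  refine PosDef.of_dotProduct_mulVec_pos (hM i) fun x hx => ?_
  have hn : 0 < ‖x‖ := norm_pos_iff.mpr hx
  have h := hi (‖x‖⁻¹ • x) (by simp [norm_smul, hn.ne'])
  rw [mulVec_smul, smul_dotProduct, dotProduct_smul, smul_eq_mul, smul_eq_mul] at h
  have h2 : 0 < ‖x‖⁻¹ := inv_pos.mpr hn
  simpa using pos_of_mul_pos_right (pos_of_mul_pos_right h h2.le) h2.le

variable [DecidableEq n]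

/-- Expand ∏ (1 + λ_i) over eigenvalues λ_i ≥ 0. The trace term yields strictness later, as it
vanishes only for M = 0. -/
theorem PosSemidef.one_add_trace_le_det_one_add {M : Matrix n n ℝ} (hM : M.PosSemidef) :
    1 + M.trace ≤ (1 + M).det := by
  have hdet : (1 + M).det = ∏ i, (1 + hM.1.eigenvalues i) := by
    have h : 1 + M = Unitary.conjStarAlgAut ℝ _ hM.1.eigenvectorUnitary
        (1 + diagonal (RCLike.ofReal ∘ hM.1.eigenvalues)) := by
      rw [map_add, map_one, ← hM.1.spectral_theorem]
    rw [h, Unitary.conjStarAlgAut_apply, det_mul_right_comm,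
      Unitary.mul_star_self_of_mem (SetLike.coe_mem _), one_mul, ← diagonal_one, diagonal_add, det_diagonal]
    simp
  have key : ∀ s : Finset n,
      1 + ∑ i ∈ s, hM.1.eigenvalues i ≤ ∏ i ∈ s, (1 + hM.1.eigenvalues i) := by
    intro s
    induction s using Finset.induction_on with
    | empty => simp
    | insert a s ha ih =>
      rw [Finset.sum_insert ha, Finset.prod_insert ha]
      have h0 := hM.eigenvalues_nonneg a
      have h1 : 0 ≤ ∑ i ∈ s, hM.1.eigenvalues i :=
        Finset.sum_nonneg fun i _ => hM.eigenvalues_nonneg i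
      nlinarith
  rw [hdet, hM.1.trace_eq_sum_eigenvalues]
  exact key Finset.univ

open scoped MatrixOrder in
-- Factor A = CᴴC and take M to be B transported by the congruence C⁻¹.
theorem PosDef.exists_det_add_eq {A B : Matrix n n ℝ} (hA : A.PosDef) (hB : B.PosSemidef) :
    ∃ M : Matrix n n ℝ, M.PosSemidef ∧ (M = 0 → B = 0) ∧ (A + B).det = A.det * (1 + M).det := by
  obtain ⟨C, hC⟩ := CStarAlgebra.nonneg_iff_eq_star_mul_self.mp hA.posSemidef.nonneg
  rw [star_eq_conjTranspose] at hC
  have hCu : IsUnit C.det := by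
    have := hA.det_pos.ne'
    rw [hC, det_mul] at this
    exact (right_ne_zero_of_mul this).isUnit
  have hB' : Cᴴ * (C⁻¹ᴴ * B * C⁻¹) * C = B := by
    have h1 : C⁻¹ * C = 1 := nonsing_inv_mul C hCu
    have h2 : Cᴴ * C⁻¹ᴴ = 1 := by rw [← conjTranspose_mul, h1, conjTranspose_one]
    calc Cᴴ * (C⁻¹ᴴ * B * C⁻¹) * C = (Cᴴ * C⁻¹ᴴ) * B * (C⁻¹ * C) := by simp only [mul_assoc]
      _ = B := by rw [h1, h2, one_mul, mul_one]
  refine ⟨C⁻¹ᴴ * B * C⁻¹, hB.conjTranspose_mul_mul_same _, fun h => ?_, ?_⟩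
  · rw [← hB', h, mul_zero, zero_mul]
  · have : A + B = Cᴴ * (1 + C⁻¹ᴴ * B * C⁻¹) * C := by
      rw [mul_add, add_mul, hB', mul_one, ← hC]
    rw [this, det_mul, det_mul]
    conv_rhs => rw [hC, det_mul]
    ring

theorem PosDef.det_le_det_add {A B : Matrix n n ℝ} (hA : A.PosDef) (hB : B.PosSemidef) :
    A.det ≤ (A + B).det := by
  obtain ⟨M, hM, -, h⟩ := hA.exists_det_add_eq hB
  rw [h]
  have := hM.one_add_trace_le_det_one_add
  have := hM.trace_nonneg
  exact le_mul_of_one_le_right hA.det_pos.le (by linarith)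

theorem PosDef.det_lt_det_add {A B : Matrix n n ℝ} (hA : A.PosDef) (hB : B.PosSemidef)
    (hB0 : B ≠ 0) : A.det < (A + B).det := by
  obtain ⟨M, hM, hM0, h⟩ := hA.exists_det_add_eq hB
  rw [h]
  have := hM.one_add_trace_le_det_one_add
  have : 0 < M.trace :=
    hM.trace_nonneg.lt_of_ne' fun h => hB0 (hM0 (hM.trace_eq_zero_iff.mp h))
  exact lt_mul_of_one_lt_right hA.det_pos (by linarith)

end Matrix

namespace MarkovChainCov

/-- If `⟪h, h⟫ + ⟪h, T h⟫` vanishes then so does `⟪h, k⟫ + ⟪h, T k⟫` for every `k`. -/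
theorem inner_add_inner_eq_zero {H : Type*} [NormedAddCommGroup H] [InnerProductSpace ℝ H]
    {T : H →ₗ[ℝ] H} (hT : T.IsSymmetric)
    (hpos : ∀ x, 0 ≤ inner ℝ x x + inner ℝ x (T x)) {h : H}
    (h0 : inner ℝ h h + inner ℝ h (T h) = 0) (k : H) :
    inner ℝ h k + inner ℝ h (T k) = 0 := by
  have hs : inner ℝ k h + inner ℝ k (T h) = inner ℝ h k + inner ℝ h (T k) := by
    rw [real_inner_comm, ← hT k h, real_inner_comm h (T k)]
  by_contra hc
  set b := inner ℝ h k + inner ℝ h (T k) with hb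
  set q := inner ℝ k k + inner ℝ k (T k) with hq
  -- The form at s h + k is affine in s because `h0` kills the quadratic term; being nonnegative, it
  -- has slope zero.
  have key : ∀ s : ℝ, 0 ≤ 2 * s * b + q := by
    intro s
    have := hpos (s • h + k)
    simp only [map_add, map_smul, inner_add_left, inner_add_right, real_inner_smul_left,
      real_inner_smul_right] at this
    refine this.trans_eq ?_
    linear_combination s ^ 2 * h0 + s * hs - s * hb - hq
  -- At this s the affine expression equals -1.
  have := key (-(q + 1) / (2 * b))
  field_simp at this
  linarith

section Moments

variable {H : Type*} [NormedAddCommGroup H] [InnerProductSpace ℝ H] {T : H →ₗ[ℝ] H}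

theorem inner_pow_add (hT : T.IsSymmetric) (x y : H) (m n : ℕ) :
    inner ℝ ((T ^ m) x) ((T ^ n) y) = inner ℝ x ((T ^ (m + n)) y) := by
  rw [pow_add, Module.End.mul_apply, hT.pow m x]

/-- The hypothesis says ‖T^i x‖² = 0; for symmetric `T` the exponent then descends to 1. -/
theorem inner_pow_eq_zero_of_sq (hT : T.IsSymmetric) {x : H} {i : ℕ} (hi : 1 ≤ i)
    (h : inner ℝ x ((T ^ (2 * i)) x) = 0) {t : ℕ} (ht : 1 ≤ t) : (T ^ t) x = 0 := by
  induction i, hi using Nat.le_induction with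
  | base =>
    have h1 : (T ^ 1) x = 0 := by
      rw [← inner_self_eq_zero (𝕜 := ℝ), inner_pow_add hT]
      exact h
    obtain ⟨s, rfl⟩ := Nat.exists_eq_add_of_le' ht
    rw [pow_add, Module.End.mul_apply, h1, map_zero]
  | succ i hi ih =>
    apply ih
    have h1 : (T ^ (i + 1)) x = 0 := by
      rw [← inner_self_eq_zero (𝕜 := ℝ), inner_pow_add hT, ← two_mul]
      exact h
    have : 2 * i = (i - 1) + (i + 1) := by omega
    rw [this, pow_add, Module.End.mul_apply, h1, map_zero, inner_zero_right]

/-- If a pair of adjacent moments of `x` of order `2 i ≥ 2` cancels, then `T ^ i x` is an eigenvector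
for the eigenvalue `-1` or zero. Convergence of the moments to zero excludes the former. -/
theorem pow_apply_eq_zero_of_pair_eq_zero (hT : T.IsSymmetric)
    (hpos : ∀ x, 0 ≤ inner ℝ x x + inner ℝ x (T x)) {x : H}
    (hlim : Tendsto (fun n => inner ℝ x ((T ^ n) x)) atTop (𝓝 0)) {i : ℕ} (hi : 1 ≤ i)
    (h : inner ℝ x ((T ^ (2 * i)) x) + inner ℝ x ((T ^ (2 * i + 1)) x) = 0) {t : ℕ} (ht : 1 ≤ t) :
    (T ^ t) x = 0 := by
  have h0 : inner ℝ ((T ^ i) x) ((T ^ i) x) + inner ℝ ((T ^ i) x) (T ((T ^ i) x)) = 0 := by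
    rw [← Module.End.mul_apply, ← pow_succ', inner_pow_add hT, inner_pow_add hT,
      ← add_assoc, ← two_mul]
    exact h
  -- Pair (1 + T) T^i x with T^(n - i) x.
  have hstep : ∀ n, 2 * i ≤ n →
      inner ℝ x ((T ^ (n + 1)) x) = -inner ℝ x ((T ^ n) x) := by
    intro n hn
    have := inner_add_inner_eq_zero hT hpos h0 ((T ^ (n - i)) x)
    rw [← Module.End.mul_apply, ← pow_succ', inner_pow_add hT, inner_pow_add hT,
      show i + (n - i) = n by omega, show i + (n - i + 1) = n + 1 by omega] at this
    linarith
  have hconst : ∀ k, inner ℝ x ((T ^ (2 * i + 2 * k)) x) = inner ℝ x ((T ^ (2 * i)) x) := by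
    intro k
    induction k with
    | zero => simp
    | succ k ih =>
      rw [show 2 * i + 2 * (k + 1) = (2 * i + 2 * k + 1) + 1 by ring, hstep _ (by omega),
        hstep _ (by omega), neg_neg, ih]
  have hlim' : Tendsto (fun k : ℕ => inner ℝ x ((T ^ (2 * i + 2 * k)) x)) atTop (𝓝 0) :=
    hlim.comp (tendsto_atTop_mono (fun k => by simp only [id]; omega) tendsto_id)
  simp only [hconst] at hlim'
  exact inner_pow_eq_zero_of_sq hT hi (tendsto_nhds_unique tendsto_const_nhds hlim') ht

variable {p : ℕ} {u : Fin p → H} {γ : ℕ → Matrix (Fin p) (Fin p) ℝ}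

theorem dotProduct_mulVec_eq_inner (hγ : ∀ t a b, γ t a b = inner ℝ (u a) ((T ^ t) (u b)))
    (t : ℕ) (v w : Fin p → ℝ) :
    v ⬝ᵥ (γ t).mulVec w = inner ℝ (∑ a, v a • u a) ((T ^ t) (∑ a, w a • u a)) := by
  simp only [dotProduct, Matrix.mulVec, hγ, map_sum, map_smul, sum_inner, inner_sum,
    real_inner_smul_left, real_inner_smul_right, Finset.mul_sum]
  rw [Finset.sum_comm]
  refine Finset.sum_congr rfl fun a _ => Finset.sum_congr rfl fun b _ => by ring

theorem isHermitian_of_inner (hT : T.IsSymmetric)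
    (hγ : ∀ t a b, γ t a b = inner ℝ (u a) ((T ^ t) (u b))) (t : ℕ) : (γ t).IsHermitian := by
  ext a b
  rw [Matrix.conjTranspose_apply, star_trivial, hγ, hγ, ← hT.pow t, real_inner_comm]

theorem posSemidef_pairSum (hT : T.IsSymmetric)
    (hpos : ∀ x, 0 ≤ inner ℝ x x + inner ℝ x (T x))
    (hγ : ∀ t a b, γ t a b = inner ℝ (u a) ((T ^ t) (u b))) (i : ℕ) :
    (pairSum γ i).PosSemidef := by
  refine Matrix.PosSemidef.of_dotProduct_mulVec_nonneg
    ((isHermitian_of_inner hT hγ _).add (isHermitian_of_inner hT hγ _)) fun v => ?_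
  rw [star_trivial, pairSum, Matrix.add_mulVec, dotProduct_add, dotProduct_mulVec_eq_inner hγ,
    dotProduct_mulVec_eq_inner hγ]
  have := hpos ((T ^ i) (∑ a, v a • u a))
  rw [← Module.End.mul_apply, ← pow_succ', inner_pow_add hT, inner_pow_add hT,
    ← add_assoc, ← two_mul] at this
  exact this

theorem partialCov_succ (γ : ℕ → Matrix (Fin p) (Fin p) ℝ) (m : ℕ) :
    partialCov γ (m + 1) = partialCov γ m + (2 : ℝ) • pairSum γ (m + 1) := by
  rw [partialCov, partialCov, Finset.sum_range_succ _ (m + 1), smul_add, add_assoc]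

theorem sum_pairSum (γ : ℕ → Matrix (Fin p) (Fin p) ℝ) (m : ℕ) :
    ∑ i ∈ Finset.range m, pairSum γ i = ∑ t ∈ Finset.range (2 * m), γ t := by
  induction m with
  | zero => simp
  | succ m ih =>
    rw [Finset.sum_range_succ, ih, show 2 * (m + 1) = 2 * m + 1 + 1 by ring,
      Finset.sum_range_succ, Finset.sum_range_succ, pairSum, add_assoc]

theorem IsAsymptoticCov.tendsto_partialCov {Sig : Matrix (Fin p) (Fin p) ℝ}
    (h : IsAsymptoticCov γ Sig) : Tendsto (partialCov γ) atTop (𝓝 Sig) := by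
  obtain ⟨G, hG, rfl⟩ := h
  -- Γ_0, …, Γ_m use up exactly γ_0, …, γ_{2m+1}.
  have h2 : Tendsto (fun m : ℕ => 2 * (m + 1)) atTop atTop :=
    tendsto_atTop_mono (fun k => by simp only [id]; omega) tendsto_id
  have := tendsto_const_nhds (x := -γ 0) |>.add ((hG.comp h2).const_smul (2 : ℝ))
  refine this.congr fun m => ?_
  rw [partialCov, sum_pairSum, Function.comp]

theorem IsAsymptoticCov.tendsto_zero {Sig : Matrix (Fin p) (Fin p) ℝ}
    (h : IsAsymptoticCov γ Sig) : Tendsto γ atTop (𝓝 0) := by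
  obtain ⟨G, hG, -⟩ := h
  have := (hG.comp (tendsto_add_atTop_nat 1)).sub hG
  rw [sub_self] at this
  refine this.congr fun n => ?_
  simp [Finset.sum_range_succ]

theorem eq_zero_of_pairSum_eq_zero (hT : T.IsSymmetric)
    (hpos : ∀ x, 0 ≤ inner ℝ x x + inner ℝ x (T x))
    (hγ : ∀ t a b, γ t a b = inner ℝ (u a) ((T ^ t) (u b)))
    (hlim : Tendsto γ atTop (𝓝 0)) {i : ℕ} (hi : 1 ≤ i) (h : pairSum γ i = 0) {t : ℕ}
    (ht : 1 ≤ t) : γ t = 0 := by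
  ext a b
  have hb : (T ^ t) (u b) = 0 := by
    refine pow_apply_eq_zero_of_pair_eq_zero hT hpos ?_ hi ?_ ht
    · simp only [← hγ]
      have h1 := (continuous_apply b).tendsto _ |>.comp
        ((continuous_apply b).tendsto _ |>.comp hlim)
      exact h1
    -- The diagonal entry (b, b) suffices: it annihilates T^t u_b, hence column b of γ_t.
    · rw [← hγ, ← hγ, ← Matrix.add_apply]
      exact congrFun (congrFun h b) b
  rw [hγ, hb, inner_zero_right, Matrix.zero_apply]

/-- The initial sequence dichotomy for autocovariances that are moments of a symmetric operator
`T` with `1 + T ≥ 0`. -/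
theorem exists_posDef_threshold (hT : T.IsSymmetric)
    (hpos : ∀ x, 0 ≤ inner ℝ x x + inner ℝ x (T x))
    (hγ : ∀ t a b, γ t a b = inner ℝ (u a) ((T ^ t) (u b)))
    {Sig : Matrix (Fin p) (Fin p) ℝ} (hSig : IsAsymptoticCov γ Sig) (hSpos : Sig.PosDef) :
    ∃ m₀ : ℕ,
      (∀ m : ℕ, (partialCov γ m).PosDef ↔ m₀ ≤ m) ∧
      (∀ m : ℕ, m₀ ≤ m → 0 < (partialCov γ m).det) ∧
      MonotoneOn (fun m => (partialCov γ m).det) (Set.Ici m₀) ∧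
      ((∃ t : ℕ, 1 ≤ t ∧ γ t ≠ 0) →
        StrictMonoOn (fun m => (partialCov γ m).det) (Set.Ici m₀)) ∧
      Tendsto (fun m => (partialCov γ m).det) atTop (𝓝 Sig.det) := by
  classical
  have hlim := hSig.tendsto_partialCov
  have hpsd : ∀ i, ((2 : ℝ) • pairSum γ i).PosSemidef := fun i =>
    (posSemidef_pairSum hT hpos hγ i).smul zero_le_two
  have hsucc : ∀ m, (partialCov γ m).PosDef → (partialCov γ (m + 1)).PosDef := fun m hm => by
    rw [partialCov_succ]
    exact hm.add_posSemidef (hpsd _)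
  have hherm : ∀ m, (partialCov γ m).IsHermitian := fun m => by
    induction m with
    | zero =>
      have h0 := (isHermitian_of_inner hT hγ 0).neg
      simpa [partialCov] using h0.add (hpsd 0).1
    | succ m ih =>
      rw [partialCov_succ]
      exact ih.add (hpsd _).1
  have hex : ∃ m, (partialCov γ m).PosDef := (hSpos.eventually hherm hlim).exists
  have hiff : ∀ m, (partialCov γ m).PosDef ↔ Nat.find hex ≤ m := fun m => by
    refine ⟨Nat.find_min' hex, fun h => ?_⟩
    induction m, h using Nat.le_induction with
    | base => exact Nat.find_spec hex
    | succ m _ ih => exact hsucc m ih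
  refine ⟨Nat.find hex, hiff, fun m hm => ((hiff m).mpr hm).det_pos, ?_, fun ⟨t, ht, ht0⟩ => ?_,
    (continuous_id.matrix_det.tendsto Sig).comp hlim⟩
  · refine monotoneOn_of_le_succ Set.ordConnected_Ici fun m _ hm _ => ?_
    rw [Order.succ_eq_add_one]
    simp only [partialCov_succ γ m]
    exact ((hiff m).mpr hm).det_le_det_add (hpsd _)
  · refine strictMonoOn_of_lt_succ Set.ordConnected_Ici fun m _ hm _ => ?_
    rw [Order.succ_eq_add_one]
    simp only [partialCov_succ γ m]
    refine ((hiff m).mpr hm).det_lt_det_add (hpsd _) fun h => ht0 ?_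
    -- The increment is 2 Γ_{m+1}, of index at least 1 even when m = 0.
    exact eq_zero_of_pairSum_eq_zero hT hpos hγ hSig.tendsto_zero (Nat.le_add_left 1 m)
      ((smul_eq_zero_iff_right two_ne_zero).mp h) ht

end Moments

end MarkovChainCov

/-! ### The transition operator on L²(F). -/

namespace MarkovChainCov

section TransitionOperator

variable {S : Type*} [MeasurableSpace S] {F : Measure S} [IsProbabilityMeasure F]
  {P : Kernel S S} [IsMarkovKernel P]

theorem measurePreserving_fst_compProd : MeasurePreserving Prod.fst (F ⊗ₘ P) F :=
  ⟨measurable_fst, Measure.fst_compProd F P⟩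

theorem measurePreserving_snd_compProd (hrev : Kernel.IsReversible P F) :
    MeasurePreserving Prod.snd (F ⊗ₘ P) F :=
  ⟨measurable_snd, (Measure.snd_compProd F P).trans hrev.invariant.def⟩

theorem measurePreserving_swap_compProd (hrev : Kernel.IsReversible P F) :
    MeasurePreserving Prod.swap (F ⊗ₘ P) (F ⊗ₘ P) := by
  refine ⟨measurable_swap, ?_⟩
  have : IsProbabilityMeasure (Measure.map Prod.swap (F ⊗ₘ P)) :=
    Measure.isProbabilityMeasure_map measurable_swap.aemeasurable
  refine Measure.ext_prod fun {s t} hs ht => ?_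
  rw [Measure.map_apply measurable_swap (hs.prod ht), Set.preimage_swap_prod,
    Measure.compProd_apply_prod ht hs, Measure.compProd_apply_prod hs ht, hrev ht hs]

/-- On `L²(F)` a reversible kernel acts as a symmetric operator `T` with `1 + T ≥ 0`. -/
theorem exists_transitionOperator (hrev : Kernel.IsReversible P F) :
    ∃ T : Lp ℝ 2 F →ₗ[ℝ] Lp ℝ 2 F, T.IsSymmetric ∧
      (∀ f, 0 ≤ inner ℝ f f + inner ℝ f (T f)) ∧
      ∀ f : Lp ℝ 2 F, T f =ᵐ[F] fun x => ∫ y, f y ∂P x := by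
  have h1 : MeasurePreserving Prod.fst (F ⊗ₘ P) F := measurePreserving_fst_compProd
  have h2 := measurePreserving_snd_compProd hrev
  let A := Lp.compMeasurePreservingₗᵢ (E := ℝ) (p := 2) ℝ Prod.fst h1
  let B := Lp.compMeasurePreservingₗᵢ (E := ℝ) (p := 2) ℝ Prod.snd h2
  have hA : ∀ f : Lp ℝ 2 F, A f =ᵐ[F ⊗ₘ P] fun z => f z.1 := fun f =>
    Lp.coeFn_compMeasurePreserving f h1
  have hB : ∀ f : Lp ℝ 2 F, B f =ᵐ[F ⊗ₘ P] fun z => f z.2 := fun f =>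
    Lp.coeFn_compMeasurePreserving f h2
  -- `A` and `B` embed L²(F) isometrically as functions of the first and second coordinate, so A*B
  -- is conditional expectation given the first.
  let T := (A.toContinuousLinearMap.adjoint ∘L B.toContinuousLinearMap : Lp ℝ 2 F →L[ℝ] Lp ℝ 2 F)
  have hT : ∀ f g, inner ℝ f (T g) = inner ℝ (A f) (B g) := fun f g =>
    ContinuousLinearMap.adjoint_inner_right A.toContinuousLinearMap f (B g)
  have hint : ∀ f g, inner ℝ f (T g) = ∫ z, f z.1 * g z.2 ∂(F ⊗ₘ P) := fun f g => by
    rw [hT, L2.inner_def]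
    refine integral_congr_ae ?_
    filter_upwards [hA f, hB g] with z hz1 hz2
    rw [hz1, hz2, RCLike.inner_apply, conj_trivial, mul_comm]
  refine ⟨T, fun f g => ?_, fun f => ?_, fun g => ?_⟩
  · rw [real_inner_comm]
    simp only [ContinuousLinearMap.coe_coe, hint]
    rw [← (measurePreserving_swap_compProd hrev).integral_comp
      MeasurableEquiv.prodComm.measurableEmbedding]
    simp only [Prod.fst_swap, Prod.snd_swap, mul_comm]
  · rw [ContinuousLinearMap.coe_coe, hT]
    have h3 : inner ℝ (A f) (A f) = inner ℝ f f := A.inner_map_map f f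
    have h4 : inner ℝ (B f) (B f) = inner ℝ f f := B.inner_map_map f f
    -- ⟨f, f⟩ + ⟨f, T f⟩ = ½ ‖A f + B f‖².
    have := real_inner_self_nonneg (x := A f + B f)
    rw [real_inner_add_add_self] at this
    linarith
  · have hmem : MemLp (fun z : S × S => g z.2) 2 (F ⊗ₘ P) :=
      (Lp.memLp g).comp_measurePreserving h2
    have hI : Integrable (fun z : S × S => g z.2) (F ⊗ₘ P) := hmem.integrable one_le_two
    -- The kernel formula is checked by pairing with indicators.
    refine Integrable.ae_eq_of_forall_setIntegral_eq _ _
      ((Lp.memLp _).integrable one_le_two) ?_ fun s hs _ => ?_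
    · rw [Measure.compProd] at hI
      simpa using hI.integral_compProd
    · have hs1 : Integrable (fun z : S × S => s.indicator (fun _ => (1 : ℝ)) z.1 * g z.2)
          (F ⊗ₘ P) := by
        have : (fun z : S × S => s.indicator (fun _ => (1 : ℝ)) z.1 * g z.2)
            = (Prod.fst ⁻¹' s).indicator fun z : S × S => g z.2 := by
          ext z
          by_cases hz : z.1 ∈ s <;> simp [hz]
        rw [this]
        exact hI.indicator (measurable_fst hs)
      rw [← L2.inner_indicatorConstLp_one hs (measure_ne_top F s),
        ContinuousLinearMap.coe_coe, hint]
      have : ∫ z, indicatorConstLp 2 hs (measure_ne_top F s) (1 : ℝ) z.1 * g z.2 ∂(F ⊗ₘ P)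
          = ∫ z, s.indicator (fun _ => (1 : ℝ)) z.1 * g z.2 ∂(F ⊗ₘ P) := by
        refine integral_congr_ae ?_
        filter_upwards [h1.quasiMeasurePreserving.ae (indicatorConstLp_coeFn
          (p := 2) (hs := hs) (hμs := measure_ne_top F s) (c := (1 : ℝ)))] with z hz
        rw [hz]
      rw [this, Measure.integral_compProd hs1, ← integral_indicator hs]
      refine integral_congr_ae (Eventually.of_forall fun x => ?_)
      by_cases hx : x ∈ s <;> simp [hx]

end TransitionOperator

/-! ### Autocovariances of the stationary chain as moments of `T`. -/

namespace IsMarkovChain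

variable {S : Type*} [MeasurableSpace S] {Ω : Type*} [MeasurableSpace Ω]
  {F : Measure S} {P : Kernel S S} {Pr : Measure Ω} {X : ℕ → Ω → S}

theorem measurePreserving (hX : IsMarkovChain Pr X P F) (hinv : Kernel.Invariant P F) (n : ℕ) :
    MeasurePreserving (X n) Pr F := by
  refine ⟨hX.measurable n, ?_⟩
  induction n with
  | zero => exact hX.initial
  | succ n ih =>
    ext A hA
    have h := hX.markov n Set.univ A MeasurableSet.univ hA
    simp only [Set.mem_univ, true_and, Set.ofPred_true, Measure.restrict_univ] at h
    rw [Measure.map_apply (hX.measurable _) hA]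
    refine h.trans ?_
    rw [← lintegral_map (P.measurable_coe hA) (hX.measurable n), ih,
      ← Measure.bind_apply hA P.aemeasurable, hinv.def]

theorem integral_comp_eq (hX : IsMarkovChain Pr X P F) (hinv : Kernel.Invariant P F) (n : ℕ)
    {h : S → ℝ} (hh : AEStronglyMeasurable h F) : ∫ ω, h (X n ω) ∂Pr = ∫ x, h x ∂F := by
  have hn := hX.measurePreserving hinv n
  rw [← hn.map_eq] at hh
  rw [← integral_map hn.measurable.aemeasurable hh, hn.map_eq]

variable [IsMarkovKernel P] [IsProbabilityMeasure Pr]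

theorem map_eq_compProd (hX : IsMarkovChain Pr X P F) (n : ℕ) :
    Pr.map (fun ω => ((X 0 ω, X n ω), X (n + 1) ω)) =
      Pr.map (fun ω => (X 0 ω, X n ω)) ⊗ₘ P.comap Prod.snd measurable_snd := by
  have hm : Measurable fun ω => (X 0 ω, X n ω) := (hX.measurable 0).prodMk (hX.measurable n)
  have hm' : Measurable fun ω => ((X 0 ω, X n ω), X (n + 1) ω) :=
    hm.prodMk (hX.measurable (n + 1))
  have := Measure.isProbabilityMeasure_map (μ := Pr) hm'.aemeasurable
  have := Measure.isProbabilityMeasure_map (μ := Pr) hm.aemeasurable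
  refine Measure.ext_prod fun {s A} hs hA => ?_
  rw [Measure.map_apply hm' (hs.prod hA), Measure.compProd_apply_prod hs hA,
    setLIntegral_map hs (Kernel.measurable_coe _ hA) hm]
  -- The Markov property is applied to a past event that depends only on X_0 and X_n.
  have hB : MeasurableSet {x : Fin (n + 1) → S | (x 0, x (Fin.last n)) ∈ s} :=
    ((measurable_pi_apply _).prodMk (measurable_pi_apply _)) hs
  exact hX.markov n _ A hB hA

theorem integral_mul_succ (hX : IsMarkovChain Pr X P F) (hinv : Kernel.Invariant P F)
    (n : ℕ) (f g Tg : Lp ℝ 2 F) (hT : Tg =ᵐ[F] fun x => ∫ y, g y ∂P x) :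
    ∫ ω, f (X 0 ω) * g (X (n + 1) ω) ∂Pr = ∫ ω, f (X 0 ω) * Tg (X n ω) ∂Pr := by
  have hm : Measurable fun ω => (X 0 ω, X n ω) := (hX.measurable 0).prodMk (hX.measurable n)
  have hm' : Measurable fun ω => ((X 0 ω, X n ω), X (n + 1) ω) :=
    hm.prodMk (hX.measurable (n + 1))
  have := Measure.isProbabilityMeasure_map (μ := Pr) hm.aemeasurable
  have hf := Lp.stronglyMeasurable f
  have hg := Lp.stronglyMeasurable g
  have hTg := Lp.stronglyMeasurable Tg
  have hI : Integrable (fun ω => f (X 0 ω) * g (X (n + 1) ω)) Pr :=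
    ((Lp.memLp f).comp_measurePreserving (hX.measurePreserving hinv 0)).integrable_mul
      ((Lp.memLp g).comp_measurePreserving (hX.measurePreserving hinv (n + 1)))
  have hsm : StronglyMeasurable fun z : (S × S) × S => f z.1.1 * g z.2 :=
    (hf.comp_measurable (measurable_fst.comp measurable_fst)).mul
      (hg.comp_measurable measurable_snd)
  have hI' : Integrable (fun z : (S × S) × S => f z.1.1 * g z.2)
      (Pr.map fun ω => ((X 0 ω, X n ω), X (n + 1) ω)) :=
    (integrable_map_measure hsm.aestronglyMeasurable hm'.aemeasurable).mpr hI
  have e1 : ∫ ω, f (X 0 ω) * g (X (n + 1) ω) ∂Pr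
      = ∫ z, f z.1.1 * g z.2 ∂(Pr.map fun ω => ((X 0 ω, X n ω), X (n + 1) ω)) :=
    (integral_map hm'.aemeasurable hsm.aestronglyMeasurable).symm
  rw [hX.map_eq_compProd] at e1 hI'
  rw [e1, Measure.integral_compProd hI']
  simp only [integral_const_mul, Kernel.comap_apply]
  have hk : StronglyMeasurable fun z : S × S => f z.1 * ∫ y, g y ∂P z.2 :=
    (hf.comp_measurable measurable_fst).mul
      ((hg.integral_kernel (κ := P)).comp_measurable measurable_snd)
  rw [integral_map hm.aemeasurable hk.aestronglyMeasurable]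
  refine integral_congr_ae ?_
  -- Stationarity transfers the F-a.e. formula for `Tg` to X_n.
  filter_upwards [(hX.measurePreserving hinv n).quasiMeasurePreserving.ae hT] with ω hω
  rw [hω]

/-- Conditioning on the past replaces g(X_{n+1}) by (T g)(X_n), so the induction must let g vary. -/
theorem integral_mul_eq_inner (hX : IsMarkovChain Pr X P F) (hinv : Kernel.Invariant P F)
    {T : Lp ℝ 2 F →ₗ[ℝ] Lp ℝ 2 F} (hT : ∀ f : Lp ℝ 2 F, T f =ᵐ[F] fun x => ∫ y, f y ∂P x)
    (n : ℕ) (f g : Lp ℝ 2 F) :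
    ∫ ω, f (X 0 ω) * g (X n ω) ∂Pr = inner ℝ f ((T ^ n) g) := by
  induction n generalizing g with
  | zero =>
    have hsm : StronglyMeasurable fun x => f x * g x :=
      (Lp.stronglyMeasurable f).mul (Lp.stronglyMeasurable g)
    rw [pow_zero, Module.End.one_apply, L2.inner_def]
    simp only [RCLike.inner_apply, conj_trivial, mul_comm _ (f _)]
    exact hX.integral_comp_eq hinv 0 hsm.aestronglyMeasurable
  | succ n ih =>
    rw [hX.integral_mul_succ hinv n f g (T g) (hT g), ih, pow_succ, Module.End.mul_apply]

variable [IsProbabilityMeasure F]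

theorem autocov_eq_inner (hX : IsMarkovChain Pr X P F) (hinv : Kernel.Invariant P F)
    {T : Lp ℝ 2 F →ₗ[ℝ] Lp ℝ 2 F} (hT : ∀ f : Lp ℝ 2 F, T f =ᵐ[F] fun x => ∫ y, f y ∂P x)
    {p : ℕ} {g : S → EuclideanSpace ℝ (Fin p)} (hg : MemLp g 2 F) :
    ∃ u : Fin p → Lp ℝ 2 F, ∀ t a b,
      autocov Pr X g t a b = inner ℝ (u a) ((T ^ t) (u b)) := by
  have hga : ∀ a, MemLp (fun x => g x a) 2 F := fun a =>
    hg.continuousLinearMap_comp (EuclideanSpace.proj a : EuclideanSpace ℝ (Fin p) →L[ℝ] ℝ)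
  have hc : ∀ a, MemLp (fun x => g x a - ∫ y, g y a ∂F) 2 F := fun a =>
    (hga a).sub (memLp_const _)
  -- By stationarity one centring constant per component serves at all times.
  refine ⟨fun a => (hc a).toLp _, fun t a b => ?_⟩
  have hmean : ∀ n a, ∫ ω, g (X n ω) a ∂Pr = ∫ y, g y a ∂F := fun n a =>
    hX.integral_comp_eq hinv n (hga a).1
  rw [← hX.integral_mul_eq_inner hinv hT, autocov, Matrix.of_apply, covariance]
  refine integral_congr_ae ?_
  filter_upwards [(hX.measurePreserving hinv 0).quasiMeasurePreserving.ae (hc a).coeFn_toLp,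
    (hX.measurePreserving hinv t).quasiMeasurePreserving.ae (hc b).coeFn_toLp] with ω h1 h2
  rw [h1, h2, hmean, hmean]

end IsMarkovChain

end MarkovChainCov

theorem proposition2 {S : Type*} [MeasurableSpace S] {Ω : Type*} [MeasurableSpace Ω]
    (F : Measure S) [IsProbabilityMeasure F]
    (P : Kernel S S) [IsMarkovKernel P]
    (hirr : MarkovChainCov.Irreducible P) (haper : MarkovChainCov.Aperiodic P F)
    (hrev : Kernel.IsReversible P F)
    (Pr : Measure Ω) [IsProbabilityMeasure Pr] (X : ℕ → Ω → S)
    (hX : MarkovChainCov.IsMarkovChain Pr X P F)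
    {p : ℕ} (g : S → EuclideanSpace ℝ (Fin p)) (hg : MemLp g 2 F)
    (γ : ℕ → Matrix (Fin p) (Fin p) ℝ) (hγ : γ = MarkovChainCov.autocov Pr X g)
    (Sig : Matrix (Fin p) (Fin p) ℝ)
    (hSig : MarkovChainCov.IsAsymptoticCov γ Sig) (hpos : Sig.PosDef) :
    ∃ m₀ : ℕ,
      (∀ m : ℕ, (MarkovChainCov.partialCov γ m).PosDef ↔ m₀ ≤ m) ∧
      (∀ m : ℕ, m₀ ≤ m → 0 < (MarkovChainCov.partialCov γ m).det) ∧
      MonotoneOn (fun m => (MarkovChainCov.partialCov γ m).det) (Set.Ici m₀) ∧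
      ((∃ t : ℕ, 1 ≤ t ∧ γ t ≠ 0) →
        StrictMonoOn (fun m => (MarkovChainCov.partialCov γ m).det) (Set.Ici m₀)) ∧
      Tendsto (fun m => (MarkovChainCov.partialCov γ m).det) atTop (𝓝 Sig.det) := by
  obtain ⟨T, hTsymm, hTpos, hT⟩ := MarkovChainCov.exists_transitionOperator hrev
  obtain ⟨u, hu⟩ := hX.autocov_eq_inner hrev.invariant hT hg
  subst hγ
  exact MarkovChainCov.exists_posDef_threshold hTsymm hTpos hu hSig hpos
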